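/- Let $\mathbb F$ be a field with $\operatorname{char}\mathbb F\neq 2$, let $n\ge 3$ and $1\le k\le n-1$. For a matrix $A\in M_n(\mathbb F)$ let its permanental rank $\operatorname{prk}(A)$ be the largest size of a square submatrix of $A$ with nonzero permanent (so $\operatorname{prk}(0)=0$), and put $\Lambda^{\le k}=\{A\in M_n(\mathbb F) : \operatorname{prk}(A)\le k\}$. For $\sigma\in S_n$ let $P(\sigma)=(p_{ij})$ be the permutation matrix with $p_{ij}=1$ if $j=\sigma^{-1}(i)$ and $p_{ij}=0$ otherwise. Let $T:M_n(\mathbb F)\to M_n(\mathbb F)$ be a linear map (not assumed bijective). Then $T(\Lambda^{\le k})=\Lambda^{\le k}$ if and only if there exist permutations $\sigma_1,\sigma_2\in S_n$ and diagonal matrices $D_1,D_2\in M_n(\mathbb F)$ with nonzero diagonal entries such that either $$T(A)=D_1P(\sigma_1)\,A\,P(\sigma_2)D_2\quad\text{for all }A\in M_n(\mathbb F)$$ or $$T(A)=D_1P(\sigma_1)\,A^{T}P(\sigma_2)D_2\quad\text{for all }A\in M_n(\mathbb F).$$ -/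

import Mathlib

/-- The sizes `r` of the square submatrices of `A` with nonzero permanent. A pair of order
embeddings `Fin r ↪o Fin n` is a choice of `r` rows and `r` columns; the empty submatrix
(`r = 0`) has permanent `1`. -/
def permanentalSizes {n : ℕ} {F : Type*} [Field F] (A : Matrix (Fin n) (Fin n) F) : Set ℕ :=
  {r | ∃ f g : Fin r ↪o Fin n, (A.submatrix f g).permanent ≠ 0}

/-- The permanental rank of `A`: the maximal size of a square submatrix with nonzero permanent. -/
noncomputable def permanentalRank {n : ℕ} {F : Type*} [Field F]
    (A : Matrix (Fin n) (Fin n) F) : ℕ :=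
  sSup (permanentalSizes A)

/-- The maximum in the definition of the permanental rank is attained. -/
theorem permanentalRank_isGreatest {n : ℕ} {F : Type*} [Field F]
    (A : Matrix (Fin n) (Fin n) F) : IsGreatest (permanentalSizes A) (permanentalRank A) := by
  have hb : BddAbove (permanentalSizes A) := by
    refine ⟨n, ?_⟩
    rintro r ⟨f, -, -⟩
    simpa using Fintype.card_le_of_injective f f.injective
  have hne : (permanentalSizes A).Nonempty :=
    ⟨0, OrderEmbedding.ofIsEmpty, OrderEmbedding.ofIsEmpty, by
      rw [Matrix.permanent_isEmpty]; exact one_ne_zero⟩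
  exact ⟨Nat.sSup_mem hne hb, fun _ hr => le_csSup hb hr⟩

/-- The set `Λ^{≤k}` of `n × n` matrices over `F` of permanental rank at most `k`. -/
def permanentalRankLE (n : ℕ) (F : Type*) [Field F] (k : ℕ) : Set (Matrix (Fin n) (Fin n) F) :=
  {A | permanentalRank A ≤ k}

/-- The permutation matrix `P(σ)`, with `(i, j)` entry `1` if `j = σ⁻¹ i` and `0` otherwise. -/
def permutationMatrix {n : ℕ} (F : Type*) [Field F] (σ : Equiv.Perm (Fin n)) :
    Matrix (Fin n) (Fin n) F :=
  Matrix.of fun i j => if j = σ⁻¹ i then 1 else 0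

/-! The subspaces of dimension `n * k` inside `Λ^{≤k}` are rigid enough to determine the preserver.

Order the cells row by row and record where the matrices of such a subspace have their first nonzero
entry. Since the permanent is additive in each row, `k + 1` leading cells in different rows and
columns would force a nonzero permanent of size `k + 1` (`card_le_of_leadingCells`). A König-type
count then leaves only `k` full rows or `k` full columns (`eq_rows_or_columns_of_card_le`). So the
subspace is a graph over these lines, and vanishing `2 × 2` permanents, together with `2 ≠ 0` and
three distinct columns, make the graph flat (`section_apply_eq_zero`). Hence it consists of all
matrices supported in `k` rows, or in `k` columns (`subspace_eq_rows_or_columns`).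

A linear `T` with `T(Λ^{≤k}) = Λ^{≤k}` is bijective, because `Λ^{≤k}` contains the matrix units. It
therefore carries spaces of `k` rows or columns to spaces of the same kind, and intersecting these
shows that matrix units go to multiples of matrix units (`exists_map_single`). The induced
permutation of cells respects lines (`ne_of_map_ne`), so it permutes rows and columns, up to
transposition. The block with rows `(1, 1)` and `(1, -1)` has permanent zero; preserving this makes
the weights a matrix of rank one, which is a diagonal scaling on both sides (`weights_mul_eq`). -/

open Matrix

/-! ### Permanents: reindexing, additivity in a row, block and triangular shapes -/

section Permanent

variable {ι κ R : Type*} [Fintype ι] [DecidableEq ι] [Fintype κ] [DecidableEq κ] [CommRing R]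

theorem permanent_eq_sum_prod_row (M : Matrix ι ι R) :
    M.permanent = ∑ σ : Equiv.Perm ι, ∏ i, M i (σ i) := by
  rw [← permanent_transpose]; rfl

theorem permanent_submatrix_equiv (M : Matrix ι ι R) (e₁ e₂ : κ ≃ ι) :
    (M.submatrix e₁ e₂).permanent = M.permanent := by
  unfold Matrix.permanent
  refine Fintype.sum_equiv (Equiv.equivCongr e₂ e₁) _ _ fun σ => ?_
  refine Fintype.prod_equiv e₂ _ _ fun i => ?_
  simp

theorem permanent_eq_add_of_row {M N K : Matrix ι ι R} (a : ι)
    (hM : ∀ i, i ≠ a → K i = M i) (hN : ∀ i, i ≠ a → K i = N i)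
    (ha : K a = M a + N a) : K.permanent = M.permanent + N.permanent := by
  simp only [permanent_eq_sum_prod_row, ← Finset.sum_add_distrib]
  refine Finset.sum_congr rfl fun σ _ => ?_
  rw [← Finset.mul_prod_erase _ _ (Finset.mem_univ a), ← Finset.mul_prod_erase _ _ (Finset.mem_univ a),
    ← Finset.mul_prod_erase _ _ (Finset.mem_univ a), ha, Pi.add_apply, add_mul]
  congr 2
  · exact Finset.prod_congr rfl fun i hi => by rw [hM i (Finset.ne_of_mem_erase hi)]
  · exact Finset.prod_congr rfl fun i hi => by rw [hN i (Finset.ne_of_mem_erase hi)]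

theorem permanent_eq_zero_of_row {M : Matrix ι ι R} (a : ι) (h : ∀ j, M a j = 0) :
    M.permanent = 0 := by
  rw [permanent_eq_sum_prod_row]
  exact Finset.sum_eq_zero fun σ _ => Finset.prod_eq_zero (Finset.mem_univ a) (h _)

/-- The permanent of a direct sum of a `2 × 2` block and a diagonal matrix. -/
theorem permanent_two_block (B : Matrix ι ι R) {a b : ι} (hab : a ≠ b)
    (hB : ∀ i, i ≠ a → i ≠ b → ∀ j, j ≠ i → B i j = 0) :
    B.permanent = (B a a * B b b + B a b * B b a) * ∏ i ∈ (Finset.univ.erase a).erase b, B i i := by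
  have split (h : ι → R) : ∏ i, h i = h a * (h b * ∏ i ∈ (Finset.univ.erase a).erase b, h i) := by
    rw [Finset.mul_prod_erase _ _ (Finset.mem_erase.2 ⟨hab.symm, Finset.mem_univ b⟩),
      Finset.mul_prod_erase _ _ (Finset.mem_univ a)]
  have hne : (1 : Equiv.Perm ι) ≠ Equiv.swap a b := by
    intro h
    have := congrArg (fun σ : Equiv.Perm ι => σ a) h
    simp at this
    exact hab this
  rw [permanent_eq_sum_prod_row, ← Finset.sum_subset (Finset.subset_univ {1, Equiv.swap a b}),
    Finset.sum_pair hne, split, split]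
  · have : ∏ i ∈ (Finset.univ.erase a).erase b, B i (Equiv.swap a b i)
        = ∏ i ∈ (Finset.univ.erase a).erase b, B i i := by
      refine Finset.prod_congr rfl fun i hi => ?_
      simp only [Finset.mem_erase] at hi
      rw [Equiv.swap_apply_of_ne_of_ne hi.2.1 hi.1]
    simp only [Equiv.Perm.one_apply, Equiv.swap_apply_left, Equiv.swap_apply_right, this]
    ring
  · intro σ _ hσ
    by_contra hne
    -- A permutation with a nonzero term fixes every index other than `a` and `b`, so it is the
    -- identity or the swap.
    have fix : ∀ i, i ≠ a → i ≠ b → σ i = i := by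
      intro i hia hib
      by_contra hi
      exact hne (Finset.prod_eq_zero (Finset.mem_univ i) (hB i hia hib _ hi))
    apply hσ
    have key : ∀ i, (i = a ∨ i = b) → (σ i = a ∨ σ i = b) := by
      intro i hi
      by_contra! h
      have := σ.injective (fix _ h.1 h.2)
      rw [this] at h
      tauto
    rw [Finset.mem_insert, Finset.mem_singleton]
    rcases key a (Or.inl rfl) with ha | ha
    · left
      ext i
      rcases key b (Or.inr rfl) with hb | hb
      · exact absurd (σ.injective (ha.trans hb.symm)) hab
      · by_cases hia : i = a
        · rw [hia, ha]; rfl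
        · by_cases hib : i = b
          · rw [hib, hb]; rfl
          · rw [fix i hia hib]; rfl
    · right
      ext i
      rcases key b (Or.inr rfl) with hb | hb
      · by_cases hia : i = a
        · rw [hia, ha, Equiv.swap_apply_left]
        · by_cases hib : i = b
          · rw [hib, hb, Equiv.swap_apply_right]
          · rw [fix i hia hib, Equiv.swap_apply_of_ne_of_ne hia hib]
      · exact absurd (σ.injective (ha.trans hb.symm)) hab

/-- The permanent of a matrix that is triangular for an ordering of its index set. -/
theorem permanent_of_triangular (B : Matrix ι ι R) {m : ℕ} {g : ι → Fin m}
    (hg : Function.Injective g) (hB : ∀ i j, g j < g i → B i j = 0) :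
    B.permanent = ∏ i, B i i := by
  rw [permanent_eq_sum_prod_row]
  refine (Finset.sum_eq_single 1 (fun σ _ hσ => ?_) (by simp)).trans (by simp)
  by_contra hne
  -- A nonzero term never decreases `g`. The sum of `g` is invariant under `σ`, so every inequality
  -- is an equality.
  have hle : ∀ i ∈ Finset.univ, (g i : ℕ) ≤ g (σ i) := by
    intro i _
    by_contra! hi
    exact hne (Finset.prod_eq_zero (Finset.mem_univ i) (hB _ _ hi))
  have hs : ∑ i, (g i : ℕ) = ∑ i, (g (σ i) : ℕ) :=
    (Equiv.sum_comp σ fun i => (g i : ℕ)).symm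
  rw [Finset.sum_eq_sum_iff_of_le hle] at hs
  exact hσ (Equiv.ext fun i => (hg (Fin.ext (hs i (Finset.mem_univ i)))).symm)

end Permanent

/-! ### Membership in `Λ^{≤k}` through arbitrary injections -/

section Membership

variable {n : ℕ} {F : Type*} [Field F] {k : ℕ}

theorem exists_orderEmbedding_comp_equiv {ι : Type*} [Fintype ι] [DecidableEq ι] {f : ι → Fin n}
    (hf : Function.Injective f) :
    ∃ (u : Fin (Fintype.card ι) ↪o Fin n) (e : Fin (Fintype.card ι) ≃ ι), ∀ x, f (e x) = u x := by
  have hs : (Finset.univ.image f).card = Fintype.card ι := by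
    rw [Finset.card_image_of_injective _ hf, Finset.card_univ]
  let u := (Finset.univ.image f).orderEmbOfFin hs
  have hu : ∀ x, ∃ y, f y = u x := fun x => by
    obtain ⟨y, -, hy⟩ := Finset.mem_image.1 (Finset.orderEmbOfFin_mem (Finset.univ.image f) hs x)
    exact ⟨y, hy⟩
  choose h hh using hu
  have hinj : Function.Injective h := fun x y hxy => u.injective (by rw [← hh, ← hh, hxy])
  exact ⟨u, Equiv.ofBijective h ((Fintype.bijective_iff_injective_and_card h).2
    ⟨hinj, by simp⟩), hh⟩

/-- Permanents do not see the order of rows and columns, so order embeddings may be replaced by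
injections from any finite index type. Later test submatrices are indexed by a set of rows and need
no sorting. -/
theorem permanent_submatrix_eq_zero_of_mem {A : Matrix (Fin n) (Fin n) F}
    (hA : A ∈ permanentalRankLE n F k) {ι : Type*} [Fintype ι] [DecidableEq ι]
    (hι : k < Fintype.card ι) {f g : ι → Fin n} (hf : Function.Injective f)
    (hg : Function.Injective g) : (A.submatrix f g).permanent = 0 := by
  by_contra hne
  obtain ⟨u, e, hu⟩ := exists_orderEmbedding_comp_equiv hf
  obtain ⟨v, e', hv⟩ := exists_orderEmbedding_comp_equiv hg
  have hmem : Fintype.card ι ∈ permanentalSizes A := by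
    refine ⟨u, v, ?_⟩
    have : A.submatrix u v = (A.submatrix f g).submatrix e e' := by
      ext x y
      simp [hu, hv]
    rwa [this, permanent_submatrix_equiv]
  have := (permanentalRank_isGreatest A).2 hmem
  have hA' : permanentalRank A ≤ k := hA
  omega

theorem mem_permanentalRankLE_iff {A : Matrix (Fin n) (Fin n) F} :
    A ∈ permanentalRankLE n F k ↔ ∀ r, k < r → ∀ f g : Fin r → Fin n, Function.Injective f →
      Function.Injective g → (A.submatrix f g).permanent = 0 := by
  refine ⟨fun hA r hr f g hf hg =>
    permanent_submatrix_eq_zero_of_mem hA (by simpa using hr) hf hg, fun h => ?_⟩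
  by_contra hA
  obtain ⟨f, g, hfg⟩ := (permanentalRank_isGreatest A).1
  exact hfg (h _ (not_le.1 hA) f g f.injective g.injective)

theorem transpose_mem_permanentalRankLE {A : Matrix (Fin n) (Fin n) F} :
    A.transpose ∈ permanentalRankLE n F k ↔ A ∈ permanentalRankLE n F k := by
  have key : ∀ A : Matrix (Fin n) (Fin n) F,
      A ∈ permanentalRankLE n F k → A.transpose ∈ permanentalRankLE n F k := by
    intro A hA
    rw [mem_permanentalRankLE_iff] at hA ⊢
    intro r hr f g hf hg
    rw [← transpose_submatrix, permanent_transpose]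
    exact hA r hr g f hg hf
  exact ⟨fun h => by simpa using key _ h, key A⟩

/-- A matrix supported in at most `k` rows has permanental rank at most `k`. -/
theorem mem_permanentalRankLE_of_rows {A : Matrix (Fin n) (Fin n) F} {I : Finset (Fin n)}
    (hI : I.card ≤ k) (hA : ∀ i, i ∉ I → ∀ j, A i j = 0) : A ∈ permanentalRankLE n F k := by
  rw [mem_permanentalRankLE_iff]
  intro r hr f g hf hg
  obtain ⟨a, ha⟩ : ∃ a, f a ∉ I := by
    by_contra! h
    have := Finset.card_le_card_of_injOn f (s := Finset.univ) (fun a _ => h a) hf.injOn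
    simp at this
    omega
  exact permanent_eq_zero_of_row a fun j => hA _ ha _

end Membership

/-! ### Leading cells of a subspace and a König-type count -/

section LeadingCells

variable {n : ℕ} {F : Type*} [Field F] {k : ℕ}

/-- The positions of the first nonzero entries, in the row by row order, of the matrices in `V`. -/
def leadingCells (V : Submodule F (Matrix (Fin n) (Fin n) F)) : Set (Fin n × Fin n) :=
  {p | ∃ A ∈ V, A p.1 p.2 ≠ 0 ∧ ∀ i j, (i < p.1 ∨ i = p.1 ∧ j < p.2) → A i j = 0}

/-- The first nonzero entry of a nonzero matrix of `V` sits at a leading cell by definition. Thus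
restriction to the leading cells is injective on `V`, which bounds its dimension by their number. -/
theorem eq_zero_of_leadingCells {V : Submodule F (Matrix (Fin n) (Fin n) F)}
    {A : Matrix (Fin n) (Fin n) F} (hA : A ∈ V) (h : ∀ p ∈ leadingCells V, A p.1 p.2 = 0) :
    A = 0 := by
  by_contra hne
  obtain ⟨i, hi, hmin⟩ := wellFounded_lt.has_min {i | ∃ j, A i j ≠ 0} (by
    by_contra! hc
    apply hne
    ext i j
    by_contra hij
    exact Set.eq_empty_iff_forall_notMem.1 hc i ⟨j, hij⟩)
  obtain ⟨j, hj, hmin'⟩ := wellFounded_lt.has_min {j | A i j ≠ 0} hi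
  refine hj (h (i, j) ⟨A, hA, hj, ?_⟩)
  rintro x y (hlt | ⟨rfl, hlt⟩)
  · by_contra hc
    exact hmin x ⟨y, hc⟩ hlt
  · by_contra hc
    exact hmin' y hc hlt

/-- The leading cells of a space of matrices of permanental rank at most `k` contain no `k + 1`
cells in different rows and different columns. -/
theorem card_le_of_leadingCells {V : Submodule F (Matrix (Fin n) (Fin n) F)}
    (hV : ∀ A ∈ V, A ∈ permanentalRankLE n F k) {s : Finset (Fin n)} {g : Fin n → Fin n}
    (hg : Set.InjOn g s) (hL : ∀ i ∈ s, (i, g i) ∈ leadingCells V) : s.card ≤ k := by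
  by_contra! hs
  choose! B hBV hB0 hB using hL
  -- Rows of index below `t` come from `X`; each other row `i` comes from the matrix `B i` that
  -- leads at `(i, g i)`. Lowering `t` from `n` to `0` replaces `X` entirely by leading rows.
  let M : ℕ → Matrix (Fin n) (Fin n) F → Matrix s s F := fun t X =>
    Matrix.of fun i j => if (i : ℕ) < t then X i (g j) else B i i (g j)
  have hginj : Function.Injective fun i : s => g i := fun i j hij =>
    Subtype.ext (hg i.2 j.2 hij)
  have hM : ∀ d t, t + d = n → ∀ X ∈ V, (M t X).permanent = 0 := by
    intro d
    induction d with
    | zero =>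
      intro t ht X hX
      have : M t X = X.submatrix (fun i : s => (i : Fin n)) (fun i : s => g i) := by
        ext i j
        have := (i : Fin n).2
        simp only [M, Matrix.of_apply, Matrix.submatrix_apply]
        rw [if_pos (by omega)]
      rw [this]
      exact permanent_submatrix_eq_zero_of_mem (hV X hX) (by simpa using hs)
        Subtype.val_injective hginj
    | succ d ih =>
      intro t ht X hX
      have htn : t < n := by omega
      by_cases hts : (⟨t, htn⟩ : Fin n) ∈ s
      -- `B t` vanishes above row `t`, so adding it to `X` changes only row `t` of `M (t + 1) X`.
      -- Additivity in that row exhibits the permanent of `M t X` as a difference of two vanishing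
      -- permanents.
      · have h1 := ih (t + 1) (by omega) X hX
        have h2 := ih (t + 1) (by omega) (X + B ⟨t, htn⟩) (V.add_mem hX (hBV _ hts))
        have h3 : (M (t + 1) (X + B ⟨t, htn⟩)).permanent
            = (M (t + 1) X).permanent + (M t X).permanent := by
          have hrow : ∀ i : s, i ≠ ⟨⟨t, htn⟩, hts⟩ → ∀ j,
              M (t + 1) (X + B ⟨t, htn⟩) i j = M t X i j ∧ M (t + 1) X i j = M t X i j := by
            intro i hi j
            have hit : (i : ℕ) ≠ t := fun h => hi (Subtype.ext (Fin.ext h))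
            simp only [M, Matrix.of_apply]
            by_cases hlt : (i : ℕ) < t
            · rw [if_pos (by omega), if_pos hlt, if_pos (by omega)]
              simp only [Matrix.add_apply, and_true]
              rw [hB _ hts _ _ (Or.inl (Fin.lt_def.2 hlt)), add_zero]
            · rw [if_neg (by omega), if_neg hlt, if_neg (by omega)]
              exact ⟨rfl, rfl⟩
          refine permanent_eq_add_of_row ⟨⟨t, htn⟩, hts⟩ (fun i hi => funext fun j => ?_)
            (fun i hi => funext fun j => ?_) (funext fun j => ?_)
          · rw [(hrow i hi j).1, (hrow i hi j).2]
          · rw [(hrow i hi j).1]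
          · simp [M]
        rw [h2, h1, zero_add] at h3
        exact h3.symm
      · have : M t X = M (t + 1) X := by
          ext i j
          have hit : (i : ℕ) ≠ t := fun h => hts (by
            have : (⟨t, htn⟩ : Fin n) = i := Fin.ext h.symm
            rw [this]
            exact i.2)
          simp only [M, Matrix.of_apply]
          by_cases hlt : (i : ℕ) < t
          · rw [if_pos hlt, if_pos (by omega)]
          · rw [if_neg hlt, if_neg (by omega)]
        rw [this]
        exact ih (t + 1) (by omega) X hX
  have h0 := hM n 0 (by omega) 0 V.zero_mem
  -- At `t = 0` row `i` vanishes in the columns before `g i` and is nonzero at `g i`: the matrix is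
  -- triangular for the ordering by `g`.
  rw [permanent_of_triangular _ hginj, Finset.prod_eq_zero_iff] at h0
  · obtain ⟨i, -, hi⟩ := h0
    exact hB0 i i.2 (by simpa [M] using hi)
  · intro i j hij
    simpa [M] using hB i i.2 i (g j) (Or.inr ⟨rfl, hij⟩)

/-- A set of at least `n * k` cells without `k + 1` cells in different rows and columns consists
of `k` rows or of `k` columns. -/
theorem eq_rows_or_columns_of_card_le (hkn : k < n) {L : Finset (Fin n × Fin n)}
    (hL : n * k ≤ L.card)
    (hmatch : ∀ (s : Finset (Fin n)) (g : Fin n → Fin n), Set.InjOn g s →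
      (∀ i ∈ s, (i, g i) ∈ L) → s.card ≤ k) :
    ∃ I : Finset (Fin n), I.card = k ∧ (L = I ×ˢ Finset.univ ∨ L = Finset.univ ×ˢ I) := by
  classical
  let N : Fin n → Finset (Fin n) := fun i => Finset.univ.filter fun j => (i, j) ∈ L
  -- Hall's theorem with defect: `n - k - 1` dummy columns are available to every row, so a complete
  -- matching would use real columns in at least `k + 1` rows.
  let t : Fin n → Finset (Fin n ⊕ Fin (n - k - 1)) := fun i => (N i).disjSum Finset.univ
  by_cases hall : ∀ A : Finset (Fin n), A.card ≤ (A.biUnion t).card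
  · obtain ⟨h, hinj, ht⟩ := (Finset.all_card_le_biUnion_card_iff_exists_injective t).1 hall
    exfalso
    let s := Finset.univ.filter fun i => (h i).isLeft
    let g : Fin n → Fin n := fun i => (h i).elim id fun _ => i
    have hgs : ∀ i ∈ s, h i = Sum.inl (g i) := by
      intro i hi
      have hi' : (h i).isLeft := (Finset.mem_filter.1 hi).2
      obtain ⟨y, hy⟩ := Sum.isLeft_iff.1 hi'
      simp [g, hy]
    have h1 := hmatch s g (fun i hi j hj hij => hinj (by
      rw [hgs i hi, hgs j hj, hij])) (fun i hi => by
        have := ht i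
        rw [hgs i hi] at this
        simpa [t, N] using this)
    have h2 : sᶜ.card ≤ n - k - 1 := by
      have hr : ∀ i ∈ sᶜ, h i ∈ (Finset.univ : Finset (Fin (n - k - 1))).map
          (Function.Embedding.inr : _ ↪ Fin n ⊕ Fin (n - k - 1)) := by
        intro i hi
        have hi' : ¬ (h i).isLeft := fun hc =>
          Finset.mem_compl.1 hi (Finset.mem_filter.2 ⟨Finset.mem_univ _, hc⟩)
        rcases hh : h i with y | y
        · simp [hh] at hi'
        · simp
      simpa using Finset.card_le_card_of_injOn h hr hinj.injOn
    have h3 := Finset.card_add_card_compl s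
    simp only [Fintype.card_fin] at h3
    omega
  · push Not at hall
    obtain ⟨A, hA⟩ := hall
    let C := A.biUnion N
    have hsub : C.disjSum Finset.univ ⊆ A.biUnion t := by
      have hAne : A.Nonempty := by
        rw [Finset.nonempty_iff_ne_empty]
        rintro rfl
        simp at hA
      obtain ⟨a, ha⟩ := hAne
      intro x hx
      rw [Finset.mem_biUnion]
      rcases x with x | x
      · rw [Finset.inl_mem_disjSum, Finset.mem_biUnion] at hx
        obtain ⟨i, hi, hx⟩ := hx
        exact ⟨i, hi, by simpa [t] using hx⟩
      · exact ⟨a, ha, by simp [t]⟩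
    have hc := Finset.card_le_card hsub
    rw [Finset.card_disjSum, Finset.card_univ, Fintype.card_fin] at hc
    have hLsub : L ⊆ Aᶜ ×ˢ Finset.univ ∪ A ×ˢ C := by
      rintro ⟨i, j⟩ hij
      rw [Finset.mem_union, Finset.mem_product, Finset.mem_product]
      by_cases hi : i ∈ A
      · right
        exact ⟨hi, Finset.mem_biUnion.2 ⟨i, hi, by simpa [N] using hij⟩⟩
      · left
        simpa using hi
    have hcard := (Finset.card_le_card hLsub).trans (Finset.card_union_le _ _)
    rw [Finset.card_product, Finset.card_product, Finset.card_univ, Fintype.card_fin] at hcard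
    have hAc := Finset.card_add_card_compl A
    rw [Fintype.card_fin] at hAc
    -- The violating set `A` gives at most `k` covering lines: the rows outside `A` and the columns
    -- of `C`. Here `c` is the slack; the count of cells forces both it and the overlap `Aᶜ × C` to
    -- be empty.
    obtain ⟨c, hc'⟩ : ∃ c, k = Aᶜ.card + C.card + c := ⟨k - (Aᶜ.card + C.card), by omega⟩
    have hprod : n * c + Aᶜ.card * C.card ≤ 0 := by
      have e1 : n * k = Aᶜ.card * n + n * C.card + n * c := by rw [hc']; ring
      have e2 : n * C.card = A.card * C.card + Aᶜ.card * C.card := by rw [← add_mul, hAc]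
      omega
    have hn0 : n ≠ 0 := by omega
    have hc0 : c = 0 := by
      have : n * c = 0 := by omega
      exact (mul_eq_zero.1 this).resolve_left hn0
    have hab : Aᶜ.card * C.card = 0 := by omega
    rcases mul_eq_zero.1 hab with ha | hb
    · refine ⟨C, by omega, Or.inr (Finset.eq_of_subset_of_card_le (fun p hp => ?_) ?_)⟩
      · have hA0 := Finset.card_eq_zero.1 ha
        have := hLsub hp
        simp only [hA0, Finset.empty_product, Finset.empty_union, Finset.mem_product] at this
        simpa using this.2
      · rw [Finset.card_product, Finset.card_univ, Fintype.card_fin]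
        have : C.card = k := by omega
        rwa [this]
    · refine ⟨Aᶜ, by omega, Or.inl (Finset.eq_of_subset_of_card_le (fun p hp => ?_) ?_)⟩
      · have hC0 := Finset.card_eq_zero.1 hb
        have := hLsub hp
        simpa only [hC0, Finset.product_empty, Finset.union_empty] using this
      · rw [Finset.card_product, Finset.card_univ, Fintype.card_fin]
        have : Aᶜ.card = k := by omega
        rwa [this, mul_comm]

end LeadingCells

/-! ### Classification of the subspaces of dimension `n * k` -/

section MaximalSubspaces

variable {n : ℕ} {F : Type*} [Field F] {k : ℕ}

theorem exists_perm_apply_eq {α : Type*} [DecidableEq α] {a b c d : α} (hab : a ≠ b) (hcd : c ≠ d) :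
    ∃ p : Equiv.Perm α, p a = c ∧ p b = d := by
  have hne : Equiv.swap a c b ≠ c := fun h => hab (by
    have := (Equiv.swap a c).injective ((Equiv.swap_apply_left a c).trans h.symm)
    exact this)
  refine ⟨Equiv.swap (Equiv.swap a c b) d * Equiv.swap a c, ?_, ?_⟩
  · rw [Equiv.Perm.mul_apply, Equiv.swap_apply_left,
      Equiv.swap_apply_of_ne_of_ne hne.symm hcd]
  · rw [Equiv.Perm.mul_apply, Equiv.swap_apply_left]

/-- The vanishing of the permanent of a direct sum of a `2 × 2` block and a diagonal matrix. -/
theorem two_block_eq_zero_of_mem {A : Matrix (Fin n) (Fin n) F}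
    (hA : A ∈ permanentalRankLE n F k) {s : Finset (Fin n)} (hs : k < s.card)
    (p : Equiv.Perm (Fin n)) {r i : Fin n} (hr : r ∈ s) (hi : i ∈ s) (hri : r ≠ i)
    (hdiag : ∀ x ∈ s, x ≠ r → x ≠ i → A x (p x) ≠ 0)
    (hoff : ∀ x ∈ s, x ≠ r → x ≠ i → ∀ y, y ≠ x → A x (p y) = 0) :
    A r (p r) * A i (p i) + A r (p i) * A i (p r) = 0 := by
  have h := permanent_submatrix_eq_zero_of_mem hA (ι := s) (by simpa using hs)
    (f := fun x => (x : Fin n)) (g := fun x => p x) Subtype.val_injective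
    (p.injective.comp Subtype.val_injective)
  rw [permanent_two_block (a := ⟨r, hr⟩) (b := ⟨i, hi⟩) _ (by simpa using hri)] at h
  · refine (mul_eq_zero.1 h).resolve_right (Finset.prod_ne_zero_iff.2 fun x hx => ?_)
    simp only [Finset.mem_erase, ne_eq, Finset.mem_univ, and_true] at hx
    exact hdiag x x.2 (fun hc => hx.2 (Subtype.ext hc)) (fun hc => hx.1 (Subtype.ext hc))
  · intro x hxr hxi y hyx
    exact hoff x x.2 (fun hc => hxr (Subtype.ext hc)) (fun hc => hxi (Subtype.ext hc)) y
      (fun hc => hyx (Subtype.ext hc))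

theorem sum_single_perm_apply (I : Finset (Fin n)) (p : Equiv.Perm (Fin n)) (x y : Fin n) :
    (∑ z ∈ I, Matrix.single z (p z) (1 : F)) x y = if x ∈ I ∧ p x = y then 1 else 0 := by
  rw [Matrix.sum_apply]
  by_cases hx : x ∈ I
  · rw [Finset.sum_eq_single x]
    · simp [Matrix.single_apply, hx]
    · intro z _ hz
      simp [hz]
    · exact fun h => absurd hx h
  · rw [if_neg (fun h => hx h.1)]
    refine Finset.sum_eq_zero fun z hz => ?_
    rw [Matrix.single_apply, if_neg]
    rintro ⟨rfl, -⟩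
    exact hx hz

/-- If the matrices of a space of permanental rank at most `k` are determined by their entries in
`k` rows, which are arbitrary, then their other entries vanish. -/
theorem section_apply_eq_zero (h2 : (2 : F) ≠ 0) (hn : 3 ≤ n) {I : Finset (Fin n)}
    (hI : I.card = k) (φ : Matrix (Fin n) (Fin n) F →ₗ[F] Matrix (Fin n) (Fin n) F)
    (hφ : ∀ X, φ X ∈ permanentalRankLE n F k) (hφI : ∀ X, ∀ i ∈ I, ∀ j, φ X i j = X i j)
    {r i : Fin n} (hr : r ∉ I) (hi : i ∈ I) (d c : Fin n) :
    φ (Matrix.single i d 1) r c = 0 := by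
  -- Outside rows `r` and `i`, `X` is given a single `1` per row of `I`, along `p`. The submatrix on
  -- the rows `insert r I` is then a `2 × 2` block plus an identity, so the permanent of the block
  -- vanishes.
  have key : ∀ i ∈ I, ∀ (p : Equiv.Perm (Fin n)) (X : Matrix (Fin n) (Fin n) F),
      (∀ x ∈ I, x ≠ i → ∀ y, X x y = (∑ z ∈ I, Matrix.single z (p z) (1 : F)) x y) →
      φ X r (p r) * X i (p i) + φ X r (p i) * X i (p r) = 0 := by
    intro i hi p X hX
    have hri : r ≠ i := fun h => hr (h ▸ hi)
    have := two_block_eq_zero_of_mem (hφ X) (s := insert r I)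
      (by rw [Finset.card_insert_of_notMem hr]; omega) p (Finset.mem_insert_self r I)
      (Finset.mem_insert_of_mem hi) hri ?_ ?_
    · rwa [hφI X i hi, hφI X i hi] at this
    · intro x hx hxr hxi
      have hxI := Finset.mem_of_mem_insert_of_ne hx hxr
      rw [hφI X x hxI, hX x hxI hxi, sum_single_perm_apply, if_pos ⟨hxI, rfl⟩]
      exact one_ne_zero
    · intro x hx hxr hxi y hy
      have hxI := Finset.mem_of_mem_insert_of_ne hx hxr
      rw [hφI X x hxI, hX x hxI hxi, sum_single_perm_apply, if_neg]
      exact fun h => hy (p.injective h.2).symm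
  have off : ∀ i ∈ I, ∀ d c, d ≠ c → φ (Matrix.single i d 1) r c = 0 := by
    intro i hi d c hdc
    have hri : r ≠ i := fun h => hr (h ▸ hi)
    obtain ⟨p, hpr, hpi⟩ := exists_perm_apply_eq hri hdc.symm
    -- Comparing the partial permutation matrix with its perturbation at `(i, d)` isolates the
    -- wanted entry, multiplied by `1 + 1`.
    have h1 := key i hi p (∑ z ∈ I, Matrix.single z (p z) (1 : F)) (fun _ _ _ _ => rfl)
    have h3 := key i hi p (∑ z ∈ I, Matrix.single z (p z) (1 : F) + Matrix.single i d 1)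
      (fun x _ hx y => by simp [Ne.symm hx])
    simp only [map_add, Matrix.add_apply, sum_single_perm_apply, hpr, hpi, hi, hdc,
      if_false, mul_zero, add_zero, Matrix.single_apply, if_true, and_true, and_false, mul_one] at h1 h3
    rw [h1, zero_add, one_add_one_eq_two] at h3
    exact (mul_eq_zero.1 h3).resolve_right h2
  have hri : r ≠ i := fun h => hr (h ▸ hi)
  have anti : ∀ c d, c ≠ d →
      φ (Matrix.single i c 1) r c + φ (Matrix.single i d 1) r d = 0 := by
    intro c d hcd
    -- With `p r = c` and `p i = d`, row `i` of the test matrix has ones at both `c` and `d`. The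
    -- entries already known to vanish leave only the two terms of the claim.
    obtain ⟨p, hpr, hpi⟩ := exists_perm_apply_eq hri hcd
    have h3 := key i hi p (∑ z ∈ I, Matrix.single z (p z) (1 : F) + Matrix.single i c 1)
      (fun x _ hx y => by simp [Ne.symm hx])
    have hc : (∑ z ∈ I, φ (Matrix.single z (p z) (1 : F))) r c = 0 := by
      rw [Matrix.sum_apply]
      refine Finset.sum_eq_zero fun z hz => off z hz _ _ fun h => hr ?_
      rw [← hpr] at h
      exact p.injective h ▸ hz
    have hd : (∑ z ∈ I, φ (Matrix.single z (p z) (1 : F))) r d = φ (Matrix.single i d 1) r d := by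
      rw [Matrix.sum_apply, Finset.sum_eq_single i, hpi]
      · intro z hz hzi
        refine off z hz _ _ fun h => hzi ?_
        rw [← hpi] at h
        exact p.injective h
      · exact fun h => absurd hi h
    simp only [map_add, map_sum, Matrix.add_apply, hc, hd, hpr, hpi, sum_single_perm_apply, hi,
      off i hi c d hcd, Matrix.single_apply, hcd, hcd.symm, true_and, if_true, if_false, zero_add,
      add_zero, mul_one] at h3
    exact h3
  by_cases hdc : d = c
  · subst hdc
    -- Three quantities whose pairwise sums are zero vanish when `2 ≠ 0`; this is where three
    -- columns are needed.
    obtain ⟨e, he⟩ : ∃ e : Fin n, e ∉ ({d} : Finset (Fin n)) := by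
      by_contra! h
      have := Finset.card_le_card (fun x _ => h x : Finset.univ ⊆ ({d} : Finset (Fin n)))
      simp at this
      omega
    obtain ⟨e', he'⟩ : ∃ e' : Fin n, e' ∉ ({d, e} : Finset (Fin n)) := by
      by_contra! h
      have := (Finset.card_le_card (fun x _ => h x : Finset.univ ⊆ ({d, e} : Finset (Fin n)))).trans
        Finset.card_le_two
      simp at this
      omega
    simp only [Finset.mem_singleton, Finset.mem_insert, not_or] at he he'
    have e1 := anti d e (Ne.symm he)
    have e2 := anti d e' (Ne.symm he'.1)
    have e3 := anti e e' (Ne.symm he'.2)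
    refine (mul_eq_zero.1 (?_ : (2 : F) * _ = 0)).resolve_left h2
    linear_combination e1 + e2 - e3
  · exact off i hi d c hdc

/-- The map `φ` parametrizes `V` by the entries in the rows of `I`. Its values vanish in the other
rows by `section_apply_eq_zero` and linearity, so `φ` is the projection onto those rows and `V` is
its image. -/
theorem mem_iff_of_section (h2 : (2 : F) ≠ 0) (hn : 3 ≤ n) {I : Finset (Fin n)}
    (hI : I.card = k) {V : Submodule F (Matrix (Fin n) (Fin n) F)}
    (hV : ∀ A ∈ V, A ∈ permanentalRankLE n F k)
    (hV0 : ∀ A ∈ V, (∀ i ∈ I, ∀ j, A i j = 0) → A = 0)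
    (φ : Matrix (Fin n) (Fin n) F →ₗ[F] Matrix (Fin n) (Fin n) F)
    (hφ : ∀ X, φ X ∈ V) (hφI : ∀ X, ∀ i ∈ I, ∀ j, φ X i j = X i j)
    (A : Matrix (Fin n) (Fin n) F) : A ∈ V ↔ ∀ i, i ∉ I → ∀ j, A i j = 0 := by
  have hrow : ∀ X, ∀ r, r ∉ I → ∀ c, φ X r c = 0 := by
    intro X r hr c
    have hsingle : ∀ i d, φ (Matrix.single i d 1) r c = 0 := by
      intro i d
      by_cases hi : i ∈ I
      · exact section_apply_eq_zero h2 hn hI φ (fun X => hV _ (hφ X)) hφI hr hi d c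
      · rw [hV0 _ (hφ _), Matrix.zero_apply]
        intro x hx y
        rw [hφI _ x hx, Matrix.single_apply, if_neg]
        rintro ⟨rfl, -⟩
        exact hi hx
    conv_lhs => rw [Matrix.matrix_eq_sum_single X]
    rw [map_sum, Matrix.sum_apply]
    refine Finset.sum_eq_zero fun i _ => ?_
    rw [map_sum, Matrix.sum_apply]
    refine Finset.sum_eq_zero fun d _ => ?_
    have : Matrix.single i d (X i d) = X i d • Matrix.single i d (1 : F) := by
      rw [Matrix.smul_single, smul_eq_mul, mul_one]
    rw [this, map_smul, Matrix.smul_apply, hsingle, smul_zero]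
  constructor
  · intro hA i hi j
    have : A - φ A = 0 := hV0 _ (V.sub_mem hA (hφ A)) fun x hx y => by
      rw [Matrix.sub_apply, hφI A x hx, sub_self]
    rw [sub_eq_zero.1 this]
    exact hrow A i hi j
  · intro hA
    have : φ A = A := by
      ext x y
      by_cases hx : x ∈ I
      · exact hφI A x hx y
      · rw [hrow A x hx, hA x hx]
    exact this ▸ hφ A

/-- The subspaces of dimension `n * k` of matrices of permanental rank at most `k` consist of the
matrices supported in `k` given rows, or in `k` given columns. -/
theorem subspace_eq_rows_or_columns (h2 : (2 : F) ≠ 0) (hn : 3 ≤ n) (hkn : k < n)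
    {V : Submodule F (Matrix (Fin n) (Fin n) F)} (hV : ∀ A ∈ V, A ∈ permanentalRankLE n F k)
    (hdim : Module.finrank F V = n * k) :
    ∃ I : Finset (Fin n), I.card = k ∧ ((∀ A, A ∈ V ↔ ∀ i, i ∉ I → ∀ j, A i j = 0) ∨
      ∀ A, A ∈ V ↔ ∀ j, j ∉ I → ∀ i, A i j = 0) := by
  classical
  let L : Finset (Fin n × Fin n) := (leadingCells V).toFinset
  let ρ : Matrix (Fin n) (Fin n) F →ₗ[F] (L → F) :=
    { toFun := fun A p => A p.1.1 p.1.2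
      map_add' := fun _ _ => rfl
      map_smul' := fun _ _ => rfl }
  let ρV := ρ ∘ₗ V.subtype
  have hzero : ∀ A ∈ V, (∀ p ∈ L, A p.1 p.2 = 0) → A = 0 := fun A hA h =>
    eq_zero_of_leadingCells hA fun p hp => h p (by simpa [L] using hp)
  have hinj : Function.Injective ρV := by
    rw [injective_iff_map_eq_zero]
    intro A hA
    exact Subtype.ext (hzero A A.2 fun p hp => congrFun hA ⟨p, hp⟩)
  have hcard : n * k ≤ L.card := by
    have := LinearMap.finrank_le_finrank_of_injective hinj
    rwa [hdim, Module.finrank_fintype_fun_eq_card, Fintype.card_coe] at this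
  obtain ⟨I, hI, hIL⟩ := eq_rows_or_columns_of_card_le hkn hcard fun s g hg hs =>
    card_le_of_leadingCells hV hg fun i hi => by simpa [L] using hs i hi
  have hcard' : L.card = n * k := by
    rcases hIL with h | h <;> rw [h, Finset.card_product, Finset.card_univ, Fintype.card_fin, hI]
    exact mul_comm k n
  -- The count is exact, so the entries at the leading cells are free coordinates on `V`; the
  -- inverse supplies the section `φ`.
  let e : V ≃ₗ[F] (L → F) := LinearEquiv.ofInjectiveOfFinrankEq ρV hinj (by
    rw [hdim, Module.finrank_fintype_fun_eq_card, Fintype.card_coe, hcard'])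
  let φ : Matrix (Fin n) (Fin n) F →ₗ[F] Matrix (Fin n) (Fin n) F :=
    V.subtype ∘ₗ e.symm.toLinearMap ∘ₗ ρ
  have hφ : ∀ X, φ X ∈ V := fun X => (e.symm (ρ X)).2
  have hφL : ∀ X, ∀ p ∈ L, φ X p.1 p.2 = X p.1 p.2 := fun X p hp =>
    congrFun (e.apply_symm_apply (ρ X)) ⟨p, hp⟩
  refine ⟨I, hI, ?_⟩
  rcases hIL with h | h
  · left
    refine mem_iff_of_section h2 hn hI hV (fun A hA hA0 => hzero A hA fun p hp => ?_) φ hφ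
      fun X i hi j => hφL X (i, j) (by simp [h, hi])
    exact hA0 p.1 (by simpa [h] using hp) p.2
  · right
    let t := (Matrix.transposeLinearEquiv (Fin n) (Fin n) F F).toLinearMap
    intro A
    have := mem_iff_of_section h2 hn hI (V := V.comap t)
      (fun A hA => transpose_mem_permanentalRankLE.1 (hV _ hA))
      (fun A hA hA0 => by
        have : Aᵀ = 0 := hzero _ hA fun p hp => hA0 p.2 (by simpa [h] using hp) p.1
        simpa using this)
      (t ∘ₗ φ ∘ₗ t) (fun X => hφ Xᵀ) (fun X i hi j => hφL Xᵀ (j, i) (by simp [h, hi])) Aᵀ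
    exact this

end MaximalSubspaces

/-! ### Bijective preservers act on matrix units -/

section Preservers

variable {n : ℕ} {F : Type*} [Field F] {k : ℕ}

theorem permanent_scale {ι R : Type*} [Fintype ι] [DecidableEq ι] [CommRing R] (A : Matrix ι ι R)
    (d₁ d₂ : ι → R) : (Matrix.of fun i j => d₁ i * A i j * d₂ j).permanent
      = (∏ i, d₁ i) * A.permanent * ∏ i, d₂ i := by
  rw [permanent_eq_sum_prod_row, permanent_eq_sum_prod_row, Finset.mul_sum, Finset.sum_mul]
  refine Finset.sum_congr rfl fun σ _ => ?_
  simp only [Matrix.of_apply, Finset.prod_mul_distrib]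
  rw [Equiv.prod_comp σ d₂]

theorem scale_permute_mem_permanentalRankLE {A : Matrix (Fin n) (Fin n) F}
    (hA : A ∈ permanentalRankLE n F k) (σ τ : Equiv.Perm (Fin n)) (d₁ d₂ : Fin n → F) :
    (Matrix.of fun i j => d₁ i * A (σ i) (τ j) * d₂ j) ∈ permanentalRankLE n F k := by
  rw [mem_permanentalRankLE_iff] at hA ⊢
  intro r hr f g hf hg
  have := permanent_scale (A.submatrix (σ ∘ f) (τ ∘ g)) (d₁ ∘ f) (d₂ ∘ g)
  rw [hA r hr _ _ (σ.injective.comp hf) (τ.injective.comp hg), mul_zero, zero_mul] at this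
  exact this

/-- The space of matrices supported in the rows of `I`. -/
def rowSubmodule (F : Type*) [Field F] (I : Finset (Fin n)) :
    Submodule F (Matrix (Fin n) (Fin n) F) where
  carrier := {A | ∀ i, i ∉ I → ∀ j, A i j = 0}
  add_mem' {A B} hA hB i hi j := by simp [hA i hi j, hB i hi j]
  zero_mem' _ _ _ := rfl
  smul_mem' c A hA i hi j := by simp [hA i hi j]

theorem finrank_rowSubmodule (I : Finset (Fin n)) :
    Module.finrank F (rowSubmodule F I) = n * I.card := by
  let e : rowSubmodule F I ≃ₗ[F] Matrix I (Fin n) F :=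
    { toFun := fun A => Matrix.of fun i j => A.1 i j
      invFun := fun B => ⟨Matrix.of fun i j => if h : i ∈ I then B ⟨i, h⟩ j else 0,
        fun i hi j => by simp [hi]⟩
      map_add' := fun _ _ => rfl
      map_smul' := fun _ _ => rfl
      left_inv := fun A => by
        ext i j
        by_cases hi : i ∈ I
        · simp [hi]
        · simp [hi, A.2 i hi j]
      right_inv := fun B => by
        ext i j
        simp }
  rw [e.finrank_eq, Module.finrank_matrix]
  simp [mul_comm]

/-- A bijective linear preserver of `Λ^{≤k}` maps the matrices supported in `k` rows to a space
spanned by matrix units. -/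
theorem symm_single_mem_rowSubmodule (h2 : (2 : F) ≠ 0) (hn : 3 ≤ n) (hkn : k < n)
    (e : Matrix (Fin n) (Fin n) F ≃ₗ[F] Matrix (Fin n) (Fin n) F)
    (he : ∀ A, e A ∈ permanentalRankLE n F k ↔ A ∈ permanentalRankLE n F k)
    {I : Finset (Fin n)} (hI : I.card = k) {A : Matrix (Fin n) (Fin n) F}
    (hA : A ∈ rowSubmodule F I) {a b : Fin n} (hab : e A a b ≠ 0) :
    e.symm (Matrix.single a b 1) ∈ rowSubmodule F I := by
  have hV : ∀ B ∈ (rowSubmodule F I).map e.toLinearMap, B ∈ permanentalRankLE n F k := by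
    rintro _ ⟨A, hA, rfl⟩
    exact (he A).2 (mem_permanentalRankLE_of_rows hI.le hA)
  have hdim : Module.finrank F ((rowSubmodule F I).map e.toLinearMap) = n * k := by
    rw [← hI, ← finrank_rowSubmodule (F := F) I]
    exact LinearEquiv.finrank_map_eq e _
  have hAV : e A ∈ (rowSubmodule F I).map e.toLinearMap := ⟨A, hA, rfl⟩
  -- Row spaces and column spaces are both coordinate subspaces: they contain the unit at every cell
  -- where some member is nonzero.
  have hmem : Matrix.single a b (1 : F) ∈ (rowSubmodule F I).map e.toLinearMap := by
    obtain ⟨J, -, hJ | hJ⟩ := subspace_eq_rows_or_columns h2 hn hkn hV hdim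
    · rw [hJ] at hAV ⊢
      intro i hi j
      rw [Matrix.single_apply, if_neg]
      rintro ⟨rfl, -⟩
      exact hab (hAV _ hi _)
    · rw [hJ] at hAV ⊢
      intro j hj i
      rw [Matrix.single_apply, if_neg]
      rintro ⟨-, rfl⟩
      exact hab (hAV _ hj _)
  obtain ⟨B, hB, hBe⟩ := hmem
  rw [← hBe]
  simpa using hB

theorem exists_card_eq_mem_notMem (hk : 1 ≤ k) (hkn : k < n) {x y : Fin n} (hxy : x ≠ y) :
    ∃ I : Finset (Fin n), I.card = k ∧ x ∈ I ∧ y ∉ I := by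
  obtain ⟨I, h1, h2, h3⟩ := Finset.exists_subsuperset_card_eq (s := {x})
    (t := Finset.univ.erase y) (n := k) (by simpa using hxy) (by simpa using hk)
    (by rw [Finset.card_erase_of_mem (Finset.mem_univ y)]; simp; omega)
  exact ⟨I, h3, by simpa using h1, fun hy => by simpa using h2 hy⟩

/-- A bijective linear preserver of `Λ^{≤k}` maps matrix units to multiples of matrix units. -/
theorem exists_map_single (h2 : (2 : F) ≠ 0) (hn : 3 ≤ n) (hk : 1 ≤ k) (hkn : k < n)
    (e : Matrix (Fin n) (Fin n) F ≃ₗ[F] Matrix (Fin n) (Fin n) F)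
    (he : ∀ A, e A ∈ permanentalRankLE n F k ↔ A ∈ permanentalRankLE n F k)
    (p : Fin n × Fin n) : ∃ (q : Fin n × Fin n) (m : F), m ≠ 0 ∧
      e (Matrix.single p.1 p.2 1) = m • Matrix.single q.1 q.2 1 := by
  obtain ⟨u, v⟩ := p
  obtain ⟨a, b, hab⟩ : ∃ a b, e (Matrix.single u v 1) a b ≠ 0 := by
    by_contra! h
    have h0 : e (Matrix.single u v 1) = 0 := by
      ext a b
      exact h a b
    rw [LinearEquiv.map_eq_zero_iff] at h0
    have := congrFun (congrFun h0 u) v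
    simp at this
  -- The preimage of the unit at `(a, b)` lies in every space of `k` rows that include `u`, and
  -- these meet in row `u` alone. Composing with the transpose gives the same for column `v`.
  have hrow : ∀ i, u ≠ i → ∀ j, e.symm (Matrix.single a b 1) i j = 0 := by
    intro i hui j
    obtain ⟨I, hI, huI, hiI⟩ := exists_card_eq_mem_notMem hk hkn hui
    refine symm_single_mem_rowSubmodule h2 hn hkn e he hI (A := Matrix.single u v 1) ?_ hab i hiI j
    intro x hx y
    rw [Matrix.single_apply, if_neg]
    rintro ⟨rfl, -⟩
    exact hx huI
  have hcol : ∀ j, v ≠ j → ∀ i, e.symm (Matrix.single a b 1) i j = 0 := by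
    intro j hvj i
    obtain ⟨I, hI, hvI, hjI⟩ := exists_card_eq_mem_notMem hk hkn hvj
    refine symm_single_mem_rowSubmodule h2 hn hkn
      ((Matrix.transposeLinearEquiv (Fin n) (Fin n) F F).trans e)
      (fun A => (he Aᵀ).trans transpose_mem_permanentalRankLE) hI
      (A := (Matrix.single u v 1)ᵀ) ?_ hab j hjI i
    intro x hx y
    rw [Matrix.transpose_apply, Matrix.single_apply, if_neg]
    rintro ⟨-, rfl⟩
    exact hx hvI
  have hs : e.symm (Matrix.single a b 1)
      = e.symm (Matrix.single a b 1) u v • Matrix.single u v (1 : F) := by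
    ext i j
    rw [Matrix.smul_apply, Matrix.single_apply]
    by_cases hi : u = i
    · by_cases hj : v = j
      · subst hi hj
        simp
      · rw [hcol j hj]
        simp [hj]
    · rw [hrow i hi]
      simp [hi]
  have hs' := congrArg e hs
  rw [LinearEquiv.apply_symm_apply, map_smul] at hs'
  have hc : e.symm (Matrix.single a b 1) u v ≠ 0 := by
    intro h0
    rw [h0, zero_smul] at hs'
    have := congrFun (congrFun hs' a) b
    simp at this
  generalize e.symm (Matrix.single a b 1) u v = c at hs' hc
  refine ⟨(a, b), c⁻¹, inv_ne_zero hc, ?_⟩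
  dsimp only
  rw [hs', smul_smul, inv_mul_cancel₀ hc, one_smul]

theorem map_apply_of_map_single
    (e : Matrix (Fin n) (Fin n) F ≃ₗ[F] Matrix (Fin n) (Fin n) F)
    {π : Fin n × Fin n → Fin n × Fin n} (hπ : Function.Injective π) {m : Fin n × Fin n → F}
    (h : ∀ p, e (Matrix.single p.1 p.2 1) = m p • Matrix.single (π p).1 (π p).2 1)
    (A : Matrix (Fin n) (Fin n) F) (p : Fin n × Fin n) :
    e A (π p).1 (π p).2 = m p * A p.1 p.2 := by
  have hA : A = ∑ q : Fin n × Fin n, A q.1 q.2 • Matrix.single q.1 q.2 (1 : F) := by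
    conv_lhs => rw [Matrix.matrix_eq_sum_single A]
    rw [Fintype.sum_prod_type]
    simp
  conv_lhs => rw [hA]
  rw [map_sum, Matrix.sum_apply, Finset.sum_eq_single p]
  · rw [map_smul, h]
    simp [mul_comm]
  · intro q _ hq
    rw [map_smul, h, Matrix.smul_apply, Matrix.smul_apply, Matrix.single_apply, if_neg]
    · simp
    · intro hc
      exact hq (hπ (Prod.ext hc.1 hc.2))
  · simp

/-- A bijective linear preserver of `Λ^{≤k}` acts on the matrix units by a permutation. -/
theorem exists_perm_map_apply (h2 : (2 : F) ≠ 0) (hn : 3 ≤ n) (hk : 1 ≤ k) (hkn : k < n)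
    (e : Matrix (Fin n) (Fin n) F ≃ₗ[F] Matrix (Fin n) (Fin n) F)
    (he : ∀ A, e A ∈ permanentalRankLE n F k ↔ A ∈ permanentalRankLE n F k) :
    ∃ (π : Equiv.Perm (Fin n × Fin n)) (m : Fin n × Fin n → F), (∀ p, m p ≠ 0) ∧
      ∀ A p, e A (π p).1 (π p).2 = m p * A p.1 p.2 := by
  choose π m hm h using exists_map_single h2 hn hk hkn e he
  have hπ : Function.Injective π := by
    intro p q hpq
    have hpq' : e (m q • Matrix.single p.1 p.2 1) = e (m p • Matrix.single q.1 q.2 1) := by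
      rw [map_smul, map_smul, h, h, hpq, smul_comm]
    have := congrFun (congrFun (e.injective hpq') p.1) p.2
    by_contra hne
    rw [Matrix.smul_apply, Matrix.smul_apply, Matrix.single_apply, Matrix.single_apply,
      if_pos ⟨rfl, rfl⟩, if_neg (fun hc => hne (Prod.ext hc.1.symm hc.2.symm))] at this
    simp [hm] at this
  exact ⟨Equiv.ofBijective π (Finite.injective_iff_bijective.1 hπ), m, hm,
    fun A p => map_apply_of_map_single e hπ h A p⟩

theorem sum_single_perm_notMem {s : Finset (Fin n)} (hs : k < s.card) (τ : Equiv.Perm (Fin n)) :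
    (∑ z ∈ s, Matrix.single z (τ z) (1 : F)) ∉ permanentalRankLE n F k := by
  intro h
  have := permanent_submatrix_eq_zero_of_mem h (ι := s) (by simpa using hs)
    (f := fun x => (x : Fin n)) (g := fun x => τ x) Subtype.val_injective
    (τ.injective.comp Subtype.val_injective)
  have h1 : (∑ z ∈ s, Matrix.single z (τ z) (1 : F)).submatrix (fun x : s => (x : Fin n))
      (fun x : s => τ x) = 1 := by
    ext x y
    rw [Matrix.submatrix_apply, sum_single_perm_apply, Matrix.one_apply]
    simp only [Finset.coe_mem, true_and, τ.injective.eq_iff, Subtype.coe_inj]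
  rw [h1, permanent_one] at this
  exact one_ne_zero this

/-- Cells in a common line are mapped to cells in a common line. -/
theorem ne_of_map_ne (hk : 1 ≤ k) (hkn : k < n)
    (e : Matrix (Fin n) (Fin n) F ≃ₗ[F] Matrix (Fin n) (Fin n) F)
    (he : ∀ A, e A ∈ permanentalRankLE n F k ↔ A ∈ permanentalRankLE n F k)
    (π : Equiv.Perm (Fin n × Fin n)) {m : Fin n × Fin n → F} (hm : ∀ p, m p ≠ 0)
    (hπ : ∀ A p, e A (π p).1 (π p).2 = m p * A p.1 p.2) {p q : Fin n × Fin n}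
    (h₁ : (π p).1 ≠ (π q).1) (h₂ : (π p).2 ≠ (π q).2) : p.1 ≠ q.1 ∧ p.2 ≠ q.2 := by
  -- The two image cells are completed to `k + 1` cells in different rows and columns. The partial
  -- permutation matrix on them lies outside `Λ^{≤k}`, and so does its preimage `B`.
  obtain ⟨τ, hτp, hτq⟩ := exists_perm_apply_eq h₁ h₂
  obtain ⟨s, hps, -, hs⟩ := Finset.exists_subsuperset_card_eq (s := {(π p).1, (π q).1})
    (n := k + 1) (Finset.subset_univ _) (by rw [Finset.card_pair h₁]; omega) (by simpa using hkn)
  obtain ⟨B, hB⟩ := e.surjective (∑ z ∈ s, Matrix.single z (τ z) (1 : F))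
  have hBn : B ∉ permanentalRankLE n F k := by
    rw [← he, hB]
    exact sum_single_perm_notMem (by omega) τ
  have hsupp : ∀ c : Fin n × Fin n, B c.1 c.2 ≠ 0 → (π c).1 ∈ s ∧ τ (π c).1 = (π c).2 := by
    intro c hc
    by_contra hcon
    have := hπ B c
    rw [hB, sum_single_perm_apply, if_neg hcon] at this
    exact mul_ne_zero (hm c) hc this.symm
  rw [mem_permanentalRankLE_iff] at hBn
  push Not at hBn
  obtain ⟨r, hr, f, g, hf, hg, hper⟩ := hBn
  rw [permanent_eq_sum_prod_row] at hper
  obtain ⟨σ, -, hσ⟩ := Finset.exists_ne_zero_of_sum_ne_zero hper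
  rw [Finset.prod_ne_zero_iff] at hσ
  let c : Fin r → Fin n × Fin n := fun i => (f i, g (σ i))
  have hc : ∀ i, (π (c i)).1 ∈ s ∧ τ (π (c i)).1 = (π (c i)).2 := fun i =>
    hsupp (c i) (hσ i (Finset.mem_univ i))
  have hinj : Function.Injective fun i => (π (c i)).1 := by
    intro i j hij
    have h1 : π (c i) = π (c j) := Prod.ext hij (by
      rw [← (hc i).2, ← (hc j).2]
      exact congrArg τ hij)
    exact hf (congrArg Prod.fst (π.injective h1))
  -- `B` is supported on only `k + 1` cells, yet a nonzero term of a permanent of size `r > k` uses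
  -- `r` of them. So that term uses them all, including `p` and `q`.
  have himg : Finset.univ.image (fun i => (π (c i)).1) = s :=
    Finset.eq_of_subset_of_card_le (fun x hx => by
      obtain ⟨i, -, rfl⟩ := Finset.mem_image.1 hx
      exact (hc i).1) (by
      rw [Finset.card_image_of_injective _ hinj, Finset.card_univ, Fintype.card_fin]
      omega)
  have hpre : ∀ p : Fin n × Fin n, (π p).1 ∈ s → τ (π p).1 = (π p).2 → ∃ i, c i = p := by
    intro p hp hp'
    rw [← himg] at hp
    obtain ⟨i, -, hi⟩ := Finset.mem_image.1 hp
    refine ⟨i, π.injective (Prod.ext hi ?_)⟩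
    rw [← hp', ← (hc i).2]
    exact congrArg τ hi
  obtain ⟨i, hi⟩ := hpre p (hps (by simp)) hτp
  obtain ⟨j, hj⟩ := hpre q (hps (by simp)) hτq
  have hij : i ≠ j := by
    rintro rfl
    exact h₁ (by rw [← hi, ← hj])
  rw [← hi, ← hj]
  exact ⟨fun h => hij (hf h), fun h => hij (σ.injective (hg h))⟩

end Preservers

/-! ### Permutations of cells that respect lines -/

section Cells

variable {n : ℕ}

/-- If two members differ in the first coordinate, they share the second; a member off that second
coordinate would share its first with both, which is impossible. -/
theorem fst_eq_or_snd_eq_of_pairwise {α β γ : Type*} {h : α → β × γ}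
    (hh : ∀ x y, (h x).1 = (h y).1 ∨ (h x).2 = (h y).2) :
    (∀ x y, (h x).1 = (h y).1) ∨ ∀ x y, (h x).2 = (h y).2 := by
  by_contra! hcon
  obtain ⟨⟨x, y, hxy⟩, z, w, hzw⟩ := hcon
  have hc := (hh x y).resolve_left hxy
  have key : ∀ v, (h v).2 = (h x).2 := by
    intro v
    by_contra hv
    have h1 := (hh v x).resolve_right hv
    have h2 := (hh v y).resolve_right (hc ▸ hv)
    exact hxy (h1.symm.trans h2)
  exact hzw ((key z).trans (key w).symm)

/-- If a permutation of the cells maps every row into a line, then it maps all rows into rows or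
all rows into columns. -/
theorem rows_to_rows_or_rows_to_columns (π : Equiv.Perm (Fin n × Fin n))
    (hrow : ∀ i j j', (π (i, j)).1 = (π (i, j')).1 ∨ (π (i, j)).2 = (π (i, j')).2) :
    (∀ i j j', (π (i, j)).1 = (π (i, j')).1) ∨ ∀ i j j', (π (i, j)).2 = (π (i, j')).2 := by
  have hline : ∀ i, (∀ j j', (π (i, j)).1 = (π (i, j')).1) ∨
      ∀ j j', (π (i, j)).2 = (π (i, j')).2 := fun i => fst_eq_or_snd_eq_of_pairwise (hrow i)
  by_contra! hcon
  obtain ⟨⟨i, j₀, j₀', hi⟩, i', j₁, j₁', hi'⟩ := hcon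
  have h2 := (hline i).resolve_left fun h => hi (h _ _)
  have h1 := (hline i').resolve_right fun h => hi' (h _ _)
  -- Row `i` fills a whole column and row `i'` a whole row; these images meet, contradicting
  -- injectivity of `π` unless `i = i'`.
  have s1 : Function.Surjective fun j => (π (i, j)).1 :=
    Finite.surjective_of_injective fun x y hxy =>
      congrArg Prod.snd (π.injective (Prod.ext hxy (h2 x y)))
  have s2 : Function.Surjective fun j => (π (i', j)).2 :=
    Finite.surjective_of_injective fun x y hxy =>
      congrArg Prod.snd (π.injective (Prod.ext (h1 x y) hxy))
  obtain ⟨x, hx⟩ := s1 (π (i', j₁)).1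
  obtain ⟨y, hy⟩ := s2 (π (i, j₀)).2
  have : π (i, x) = π (i', y) :=
    Prod.ext (hx.trans (h1 _ _)) ((h2 _ _).trans hy.symm)
  have hii := congrArg Prod.fst (π.injective this)
  dsimp only at hii
  subst hii
  exact hi (h1 _ _)

/-- A permutation of the cells that maps cells in a common line to cells in a common line is a
pair of permutations, of the rows and of the columns, possibly followed by a transposition. -/
theorem exists_perms_of_line_preserving (hn : 2 ≤ n) (π : Equiv.Perm (Fin n × Fin n))
    (hπ : ∀ p q : Fin n × Fin n, (π p).1 ≠ (π q).1 → (π p).2 ≠ (π q).2 →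
      p.1 ≠ q.1 ∧ p.2 ≠ q.2) :
    ∃ σ τ : Equiv.Perm (Fin n), (∀ i j, π (i, j) = (σ i, τ j)) ∨ ∀ i j, π (i, j) = (τ j, σ i) := by
  have hr : ∀ i j j', (π (i, j)).1 = (π (i, j')).1 ∨ (π (i, j)).2 = (π (i, j')).2 := by
    intro i j j'
    by_contra! h
    exact (hπ _ _ h.1 h.2).1 rfl
  have hc : ∀ j i i', (π (i, j)).1 = (π (i', j)).1 ∨ (π (i, j)).2 = (π (i', j)).2 := by
    intro j i i'
    by_contra! h
    exact (hπ _ _ h.1 h.2).2 rfl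
  have hrows := rows_to_rows_or_rows_to_columns π hr
  have hcols := rows_to_rows_or_rows_to_columns ((Equiv.prodComm _ _).trans π) hc
  simp only [Equiv.trans_apply, Equiv.prodComm_apply, Prod.swap_prod_mk] at hcols
  let z : Fin n := ⟨0, by omega⟩
  let o : Fin n := ⟨1, by omega⟩
  have hzo : z ≠ o := by simp [z, o]
  have bij : ∀ f : Fin n → Fin n, (∀ a, ∃ i, f i = a) → Function.Bijective f := fun f hf =>
    Finite.surjective_iff_bijective.1 hf
  rcases hrows with h1 | h1 <;> rcases hcols with h2 | h2
  -- If rows and columns both went into rows, any two cells would have images in the same row.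
  · exfalso
    obtain ⟨p, hp⟩ := π.surjective (z, z)
    obtain ⟨q, hq⟩ := π.surjective (o, z)
    have : (π p).1 = (π q).1 := (h1 p.1 p.2 q.2).trans (h2 q.2 p.1 q.1)
    rw [hp, hq] at this
    exact hzo this
  · refine ⟨Equiv.ofBijective (fun i => (π (i, z)).1) (bij _ fun a => ?_),
      Equiv.ofBijective (fun j => (π (z, j)).2) (bij _ fun a => ?_), Or.inl fun i j =>
        Prod.ext (h1 _ _ _) (h2 _ _ _)⟩
    · obtain ⟨p, hp⟩ := π.surjective (a, z)
      exact ⟨p.1, (h1 p.1 z p.2).trans (congrArg Prod.fst hp)⟩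
    · obtain ⟨p, hp⟩ := π.surjective (z, a)
      exact ⟨p.2, (h2 p.2 z p.1).trans (congrArg Prod.snd hp)⟩
  · refine ⟨Equiv.ofBijective (fun i => (π (i, z)).2) (bij _ fun a => ?_),
      Equiv.ofBijective (fun j => (π (z, j)).1) (bij _ fun a => ?_), Or.inr fun i j =>
        Prod.ext (h2 _ _ _) (h1 _ _ _)⟩
    · obtain ⟨p, hp⟩ := π.surjective (z, a)
      exact ⟨p.1, (h1 p.1 z p.2).trans (congrArg Prod.snd hp)⟩
    · obtain ⟨p, hp⟩ := π.surjective (a, z)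
      exact ⟨p.2, (h2 p.2 z p.1).trans (congrArg Prod.fst hp)⟩
  · exfalso
    obtain ⟨p, hp⟩ := π.surjective (z, z)
    obtain ⟨q, hq⟩ := π.surjective (z, o)
    have : (π p).2 = (π q).2 := (h1 p.1 p.2 q.2).trans (h2 q.2 p.1 q.1)
    rw [hp, hq] at this
    exact hzo this

end Cells

/-! ### Weights, diagonal scalings and the converse -/

section Main

variable {n : ℕ} {F : Type*} [Field F] {k : ℕ}

/-- A square submatrix of size above `k` either contains a zero row or column, or is the
distinguished block up to reordering. -/
theorem mem_permanentalRankLE_of_submatrix {A : Matrix (Fin n) (Fin n) F} {s : Finset (Fin n)}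
    (hs : s.card = k + 1) (p : Equiv.Perm (Fin n)) (hrow : ∀ x, x ∉ s → ∀ y, A x y = 0)
    (hcol : ∀ y, y ∉ s → ∀ x, A x (p y) = 0)
    (hper : (A.submatrix (fun x : s => (x : Fin n)) fun x : s => p x).permanent = 0) :
    A ∈ permanentalRankLE n F k := by
  rw [mem_permanentalRankLE_iff]
  intro r hr f g hf hg
  by_cases hfs : ∀ a, f a ∈ s
  · by_cases hgs : ∀ b, p.symm (g b) ∈ s
    · have hrk : r = k + 1 := by
        have := Finset.card_le_card_of_injOn f (s := Finset.univ) (fun a _ => hfs a) hf.injOn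
        simp at this
        omega
      have hcard : Fintype.card (Fin r) = Fintype.card s := by simp [hs, hrk]
      let e₁ : Fin r ≃ s := Equiv.ofBijective (fun a => ⟨f a, hfs a⟩)
        ((Fintype.bijective_iff_injective_and_card _).2
          ⟨fun a b h => hf (congrArg Subtype.val h), hcard⟩)
      let e₂ : Fin r ≃ s := Equiv.ofBijective (fun b => ⟨p.symm (g b), hgs b⟩)
        ((Fintype.bijective_iff_injective_and_card _).2
          ⟨fun a b h => hg (p.symm.injective (congrArg Subtype.val h)), hcard⟩)
      have : A.submatrix f g
          = (A.submatrix (fun x : s => (x : Fin n)) fun x : s => p x).submatrix e₁ e₂ := by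
        ext a b
        simp [e₁, e₂]
      rw [this, permanent_submatrix_equiv, hper]
    · push Not at hgs
      obtain ⟨b, hb⟩ := hgs
      rw [← permanent_transpose]
      exact permanent_eq_zero_of_row b fun j => by simpa using hcol _ hb (f j)
  · push Not at hfs
    obtain ⟨a, ha⟩ := hfs
    exact permanent_eq_zero_of_row a fun j => hrow _ ha _

/-- The weights of an entrywise scaling that preserves `Λ^{≤k}` have vanishing `2 × 2` minors. -/
theorem weights_mul_eq (hk : 1 ≤ k) (hkn : k < n) {m : Fin n → Fin n → F}
    (hm : ∀ i j, m i j ≠ 0)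
    (hmem : ∀ A ∈ permanentalRankLE n F k,
      (Matrix.of fun i j => m i j * A i j) ∈ permanentalRankLE n F k)
    {i i' j j' : Fin n} (hi : i ≠ i') (hj : j ≠ j') : m i j * m i' j' = m i j' * m i' j := by
  obtain ⟨p, rfl, rfl⟩ := exists_perm_apply_eq hi hj
  obtain ⟨s, his, -, hs⟩ := Finset.exists_subsuperset_card_eq (s := {i, i'})
    (n := k + 1) (Finset.subset_univ _) (by rw [Finset.card_pair hi]; omega) (by simpa using hkn)
  have hi1 : i ∈ s := his (by simp)
  have hi2 : i' ∈ s := his (by simp)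
  -- Along `p` on `s` this is the block with rows `(1, 1)` and `(1, -1)` plus an identity, so its
  -- permanent is `-1 + 1 = 0`. After scaling, the permanent of the block is the minor of weights up
  -- to sign.
  let A : Matrix (Fin n) (Fin n) F := Matrix.of fun x y =>
    if x ∈ s then
      if x = i then (if y = p i ∨ y = p i' then 1 else 0)
      else if x = i' then (if y = p i then 1 else if y = p i' then -1 else 0)
      else if y = p x then 1 else 0
    else 0
  have hdiag : ∀ x ∈ s, x ≠ i → x ≠ i' → A x (p x) = 1 := by
    intro x hx h1 h2
    simp [A, hx, h1, h2]
  have hoff : ∀ x ∈ s, x ≠ i → x ≠ i' → ∀ y, y ≠ x → A x (p y) = 0 := by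
    intro x hx h1 h2 y hy
    simp [A, h1, h2, hy]
  have a11 : A i (p i) = 1 := by simp [A, hi1]
  have a12 : A i (p i') = 1 := by simp [A, hi1]
  have a21 : A i' (p i) = 1 := by simp [A, hi2, hi.symm]
  have a22 : A i' (p i') = -1 := by simp [A, hi2, hi.symm]
  have hA : A ∈ permanentalRankLE n F k := by
    refine mem_permanentalRankLE_of_submatrix hs p (fun x hx y => by simp [A, hx]) ?_ ?_
    · intro y hy x
      have h1 : y ≠ i := fun h => hy (h ▸ hi1)
      have h2 : y ≠ i' := fun h => hy (h ▸ hi2)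
      by_cases hx : x ∈ s
      · have h3 : y ≠ x := fun h => hy (h ▸ hx)
        simp [A, h1, h2, h3]
      · simp [A, hx]
    · rw [permanent_two_block (a := ⟨i, hi1⟩) (b := ⟨i', hi2⟩) _ (by simpa using hi)]
      · simp [a11, a12, a21, a22]
      · intro x hxi hxi' y hyx
        exact hoff x x.2 (fun hc => hxi (Subtype.ext hc)) (fun hc => hxi' (Subtype.ext hc)) y
          (fun hc => hyx (Subtype.ext hc))
  have := two_block_eq_zero_of_mem (hmem A hA) (s := s) (by omega) p hi1 hi2 hi
    (fun x hx h1 h2 => by simpa [hdiag x hx h1 h2] using hm _ _)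
    (fun x hx h1 h2 y hy => by simp [hoff x hx h1 h2 y hy])
  simp only [Matrix.of_apply, a11, a12, a21, a22] at this
  linear_combination -this

theorem scaled_permuted_apply (A : Matrix (Fin n) (Fin n) F) (σ₁ σ₂ : Equiv.Perm (Fin n))
    (d₁ d₂ : Fin n → F) (x y : Fin n) :
    (Matrix.diagonal d₁ * permutationMatrix F σ₁ * A * permutationMatrix F σ₂ *
      Matrix.diagonal d₂) x y = d₁ x * A (σ₁⁻¹ x) (σ₂ y) * d₂ y := by
  have h1 : permutationMatrix F σ₁ * A = A.submatrix (σ₁⁻¹ : Equiv.Perm (Fin n)) id := by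
    ext i j
    simp [Matrix.mul_apply, permutationMatrix]
  have h2 : ∀ B : Matrix (Fin n) (Fin n) F, B * permutationMatrix F σ₂ = B.submatrix id σ₂ := by
    intro B
    ext i j
    rw [Matrix.mul_apply, Finset.sum_eq_single (σ₂ j)]
    · simp [permutationMatrix]
    · intro z _ hz
      rw [permutationMatrix, Matrix.of_apply, if_neg, mul_zero]
      rintro rfl
      exact hz (σ₂.apply_symm_apply z).symm
    · simp
  rw [Matrix.mul_diagonal, h2, Matrix.submatrix_apply, mul_assoc (Matrix.diagonal d₁), h1,
    id, Matrix.diagonal_mul, Matrix.submatrix_apply, id]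

theorem exists_scaled_permuted_of_perms (hn : 3 ≤ n) (hk : 1 ≤ k) (hkn : k < n)
    (e : Matrix (Fin n) (Fin n) F ≃ₗ[F] Matrix (Fin n) (Fin n) F)
    (he : ∀ A, e A ∈ permanentalRankLE n F k ↔ A ∈ permanentalRankLE n F k)
    (σ τ : Equiv.Perm (Fin n)) {m : Fin n → Fin n → F} (hm : ∀ i j, m i j ≠ 0)
    (h : ∀ A i j, e A (σ i) (τ j) = m i j * A i j) :
    ∃ d₁ d₂ : Fin n → F, (∀ i, d₁ i ≠ 0) ∧ (∀ i, d₂ i ≠ 0) ∧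
      ∀ A x y, e A x y = d₁ x * A (σ⁻¹ x) (τ⁻¹ y) * d₂ y := by
  have hmem : ∀ A ∈ permanentalRankLE n F k,
      (Matrix.of fun i j => m i j * A i j) ∈ permanentalRankLE n F k := by
    intro A hA
    have := scale_permute_mem_permanentalRankLE ((he A).2 hA) σ τ (fun _ => 1) (fun _ => 1)
    simpa only [one_mul, mul_one, h] using this
  let z : Fin n := ⟨0, by omega⟩
  -- Vanishing minors through the corner `(z, z)` factor the weights into a row part and a column
  -- part.
  have hmz : ∀ i j, m i j = m i z * (m z j / m z z) := by
    intro i j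
    have hz := hm z z
    have : m i j * m z z = m i z * m z j := by
      by_cases hi : i = z
      · rw [hi, mul_comm]
      · by_cases hj : j = z
        · rw [hj]
        · exact weights_mul_eq hk hkn hm hmem hi hj
    field_simp
    exact this
  refine ⟨fun x => m (σ⁻¹ x) z, fun y => m z (τ⁻¹ y) / m z z, fun x => hm _ _,
    fun y => div_ne_zero (hm _ _) (hm _ _), fun A x y => ?_⟩
  have := h A (σ⁻¹ x) (τ⁻¹ y)
  rw [show σ (σ⁻¹ x) = x from σ.apply_symm_apply x,
    show τ (τ⁻¹ y) = y from τ.apply_symm_apply y, hmz] at this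
  rw [this]
  ring

theorem image_scaled_permuted {S : Matrix (Fin n) (Fin n) F → Matrix (Fin n) (Fin n) F}
    {σ₁ σ₂ : Equiv.Perm (Fin n)} {d₁ d₂ : Fin n → F} (hd₁ : ∀ i, d₁ i ≠ 0) (hd₂ : ∀ i, d₂ i ≠ 0)
    (hS : ∀ A, S A = Matrix.diagonal d₁ * permutationMatrix F σ₁ * A *
      permutationMatrix F σ₂ * Matrix.diagonal d₂) :
    S '' permanentalRankLE n F k = permanentalRankLE n F k := by
  have hS' : ∀ A, S A = Matrix.of fun x y => d₁ x * A (σ₁⁻¹ x) (σ₂ y) * d₂ y := by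
    intro A
    ext x y
    rw [hS, scaled_permuted_apply, Matrix.of_apply]
  ext B
  constructor
  · rintro ⟨A, hA, rfl⟩
    rw [hS']
    exact scale_permute_mem_permanentalRankLE hA σ₁⁻¹ σ₂ d₁ d₂
  · intro hB
    refine ⟨_, scale_permute_mem_permanentalRankLE hB σ₁ σ₂⁻¹ (fun u => (d₁ (σ₁ u))⁻¹)
      (fun v => (d₂ (σ₂⁻¹ v))⁻¹), ?_⟩
    rw [hS']
    ext x y
    have h1 := hd₁ x
    have h2 := hd₂ y
    rw [Matrix.of_apply, Matrix.of_apply, show σ₁ (σ₁⁻¹ x) = x from σ₁.apply_symm_apply x,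
      show σ₂⁻¹ (σ₂ y) = y from σ₂.symm_apply_apply y]
    field_simp

end Main

theorem theorem1p2 {F : Type*} [Field F] (hF : ringChar F ≠ 2)
    (n : ℕ) (hn : 3 ≤ n) (k : ℕ) (hk : 1 ≤ k) (hkn : k ≤ n - 1)
    (T : Matrix (Fin n) (Fin n) F →ₗ[F] Matrix (Fin n) (Fin n) F) :
    T '' permanentalRankLE n F k = permanentalRankLE n F k ↔
      ∃ (σ₁ σ₂ : Equiv.Perm (Fin n)) (d₁ d₂ : Fin n → F),
        (∀ i, d₁ i ≠ 0) ∧ (∀ i, d₂ i ≠ 0) ∧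
        ((∀ A : Matrix (Fin n) (Fin n) F,
            T A = Matrix.diagonal d₁ * permutationMatrix F σ₁ * A *
              permutationMatrix F σ₂ * Matrix.diagonal d₂) ∨
         (∀ A : Matrix (Fin n) (Fin n) F,
            T A = Matrix.diagonal d₁ * permutationMatrix F σ₁ * A.transpose *
              permutationMatrix F σ₂ * Matrix.diagonal d₂)) := by
  have h2 : (2 : F) ≠ 0 := Ring.two_ne_zero hF
  have hkn' : k < n := by omega
  constructor
  · intro hT
    -- As `1 ≤ k`, every multiple of a matrix unit lies in `Λ^{≤k}`, hence in the range of `T`, and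
    -- these span. Bijectivity then upgrades equality of sets to an equivalence for membership.
    have hsurj : Function.Surjective T := by
      rw [← LinearMap.range_eq_top, eq_top_iff]
      intro A _
      rw [Matrix.matrix_eq_sum_single A]
      refine Submodule.sum_mem _ fun i _ => Submodule.sum_mem _ fun j _ => ?_
      have hmem : Matrix.single i j (A i j) ∈ permanentalRankLE n F k :=
        mem_permanentalRankLE_of_rows (I := {i}) (by simpa using hk) fun x hx y => by
          rw [Finset.mem_singleton] at hx
          rw [Matrix.single_apply, if_neg fun h => hx h.1.symm]
      rw [← hT] at hmem
      obtain ⟨B, -, hB⟩ := hmem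
      exact ⟨B, hB⟩
    let e := LinearEquiv.ofBijective T ⟨LinearMap.injective_iff_surjective.2 hsurj, hsurj⟩
    have he : ∀ A, e A ∈ permanentalRankLE n F k ↔ A ∈ permanentalRankLE n F k := by
      intro A
      constructor
      · intro hA
        rw [← hT] at hA
        obtain ⟨B, hB, hBA⟩ := hA
        rwa [← e.injective hBA]
      · intro hA
        rw [← hT]
        exact ⟨A, hA, rfl⟩
    obtain ⟨π, m, hm, hπ⟩ := exists_perm_map_apply h2 hn hk hkn' e he
    obtain ⟨σ, τ, hστ | hστ⟩ := exists_perms_of_line_preserving (by omega) π fun p q h₁ h₂ =>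
      ne_of_map_ne hk hkn' e he π hm hπ h₁ h₂
    · obtain ⟨d₁, d₂, hd₁, hd₂, hd⟩ := exists_scaled_permuted_of_perms hn hk hkn' e he σ τ
        (m := fun i j => m (i, j)) (fun i j => hm _) fun A i j => by
          have := hπ A (i, j)
          rwa [hστ] at this
      -- Multiplication on the right by `P(σ₂)` reads column `σ₂ y` at `y`, whence the inverse of
      -- `τ`.
      refine ⟨σ, τ⁻¹, d₁, d₂, hd₁, hd₂, Or.inl fun A => ?_⟩
      ext x y
      rw [scaled_permuted_apply]
      exact hd A x y
    · obtain ⟨d₁, d₂, hd₁, hd₂, hd⟩ := exists_scaled_permuted_of_perms hn hk hkn'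
        (e.trans (Matrix.transposeLinearEquiv (Fin n) (Fin n) F F))
        (fun A => transpose_mem_permanentalRankLE.trans (he A)) σ τ
        (m := fun i j => m (i, j)) (fun i j => hm _) fun A i j => by
          have := hπ A (i, j)
          rwa [hστ] at this
      -- The factorization holds for `T` followed by transposition; transposing back exchanges the
      -- two permutations and the two diagonals.
      refine ⟨τ, σ⁻¹, d₂, d₁, hd₂, hd₁, Or.inr fun A => ?_⟩
      ext x y
      rw [scaled_permuted_apply, Matrix.transpose_apply]
      have : T A x y = d₁ y * A (σ⁻¹ y) (τ⁻¹ x) * d₂ x := hd A y x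
      rw [this]
      ring
  · rintro ⟨σ₁, σ₂, d₁, d₂, hd₁, hd₂, h | h⟩
    · exact image_scaled_permuted hd₁ hd₂ h
    · have himg := image_scaled_permuted (k := k) (S := fun A => T Aᵀ) hd₁ hd₂
        (fun A => by rw [h, Matrix.transpose_transpose])
      refine Eq.trans ?_ himg
      ext B
      constructor
      · rintro ⟨A, hA, rfl⟩
        exact ⟨Aᵀ, transpose_mem_permanentalRankLE.2 hA, by simp⟩
      · rintro ⟨A, hA, rfl⟩
        exact ⟨Aᵀ, transpose_mem_permanentalRankLE.2 hA, rfl⟩
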